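/- A \emph{sum-network} is a finite directed acyclic multigraph with unit-capacity edges, a set of source nodes without incoming edges and a set of terminal nodes without outgoing edges. For an alphabet that is an abelian group $G$, each source generates one symbol of $G$ and each terminal demands the sum of all the source symbols. A network code over $G$ assigns to each edge leaving a source a function $G\to G$ of the symbol of that source, to each other edge $e$ a function $G^{\mathrm{In}(\mathrm{tail}(e))}\to G$ of the symbols on the edges entering its tail, and to each terminal $t$ a decoding function $G^{\mathrm{In}(t)}\to G$; no linearity is required. The network is \emph{solvable over $G$} if for some network code over $G$ every terminal recovers the sum of the source symbols, for all values of the source symbols. The \emph{reverse network} has the same nodes, all edges reversed, and the roles of sources and terminals interchanged. \textbf{Theorem.} There exists a sum-network which is solvable, i.e. solvable over some finite abelian group with at least two elements, but whose reverse network is not solvable over any finite abelian group with at least two elements. -/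

import Mathlib

/-- A sum-network: a finite directed acyclic multigraph (unit-capacity edges `E`, from `tail e` to
`head e`) with a set of sources, each generating one symbol, and a set of terminals, each demanding
the sum of all source symbols. Sources have no incoming edges; terminals have no outgoing edges,
so that interchanging the roles of sources and terminals in the reversed graph again gives
a network in the same sense. -/
structure SumNetwork where
  /-- nodes -/
  V : Type
  /-- edges; parallel edges are allowed -/
  E : Type
  [finV : Fintype V]
  [finE : Fintype E]
  tail : E → V
  head : E → V
  acyclic : ∀ v, ¬ Relation.TransGen (fun a b => ∃ e, tail e = a ∧ head e = b) v v
  sources : Finset V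
  terminals : Finset V
  head_notMem_sources : ∀ e, head e ∉ sources
  tail_notMem_terminals : ∀ e, tail e ∉ terminals

namespace SumNetwork

/-- The reverse network: same nodes, all edges reversed, sources and terminals interchanged. -/
def reverse (N : SumNetwork) : SumNetwork where
  V := N.V
  E := N.E
  finV := N.finV
  finE := N.finE
  tail := N.head
  head := N.tail
  acyclic := fun v h => N.acyclic v <| by
    have h' := (Relation.transGen_swap
      (r := fun a b => ∃ e, N.tail e = a ∧ N.head e = b) (a := v) (b := v)).1
    apply h'
    refine Relation.TransGen.mono ?_ _ _ h
    rintro a b ⟨e, rfl, rfl⟩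
    exact ⟨e, rfl, rfl⟩
  sources := N.terminals
  terminals := N.sources
  head_notMem_sources := N.tail_notMem_terminals
  tail_notMem_terminals := N.head_notMem_sources

/-- `In(v)`, the edges entering the node `v`. -/
abbrev In (N : SumNetwork) (v : N.V) : Type := {e : N.E // N.head e = v}

/-- A (not necessarily linear) network code over the alphabet `A`: a function for every edge and a
decoding function for every terminal. An edge leaving a source carries a function of the symbol of
that source, any other edge a function of the symbols on the edges entering its tail. -/
structure Code (N : SumNetwork) (A : Type*) where
  sourceEdge : ∀ e : N.E, N.tail e ∈ N.sources → A → A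
  innerEdge : ∀ e : N.E, N.tail e ∉ N.sources → (N.In (N.tail e) → A) → A
  decode : ∀ t : N.terminals, (N.In (t : N.V) → A) → A

/-- `Y e` is the symbol carried by the edge `e` when the sources generate the symbols `X`. -/
def Code.Carries {N : SumNetwork} {A : Type*} (c : N.Code A)
    (X : N.sources → A) (Y : N.E → A) : Prop :=
  (∀ (e : N.E) (h : N.tail e ∈ N.sources), Y e = c.sourceEdge e h (X ⟨N.tail e, h⟩)) ∧
  (∀ (e : N.E) (h : N.tail e ∉ N.sources), Y e = c.innerEdge e h (fun e' => Y e'.1))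

/-- The edge relation is well founded: the network is finite and acyclic. -/
theorem wellFounded_edge (N : SumNetwork) :
    WellFounded (fun e' e : N.E => N.head e' = N.tail e) := by
  have := N.finV
  let r : N.V → N.V → Prop := fun a b => ∃ e, N.tail e = a ∧ N.head e = b
  have : Std.Irrefl (Relation.TransGen r) := ⟨N.acyclic⟩
  have hwf : WellFounded (Relation.TransGen r) := Finite.wellFounded_of_trans_of_irrefl _
  refine Subrelation.wf ?_ (InvImage.wf N.tail hwf)
  intro e' e h
  exact Relation.TransGen.single ⟨e', rfl, h⟩

/-- For given source symbols, a code determines the symbols on all edges. -/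
theorem Code.existsUnique_carries {N : SumNetwork} {A : Type*} (c : N.Code A)
    (X : N.sources → A) : ∃! Y : N.E → A, c.Carries X Y := by
  classical
  let F : ∀ e : N.E, (∀ e' : N.E, N.head e' = N.tail e → A) → A := fun e ih =>
    if h : N.tail e ∈ N.sources then c.sourceEdge e h (X ⟨N.tail e, h⟩)
    else c.innerEdge e h (fun e' => ih e'.1 e'.2)
  have hfix : ∀ e, N.wellFounded_edge.fix F e = F e (fun e' _ => N.wellFounded_edge.fix F e') :=
    fun e => N.wellFounded_edge.fix_eq F e
  refine ⟨N.wellFounded_edge.fix F, ⟨fun e h => ?_, fun e h => ?_⟩, ?_⟩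
  · rw [hfix e]; simp only [F]; rw [dif_pos h]
  · rw [hfix e]; simp only [F]; rw [dif_neg h]
  · rintro Y ⟨h₁, h₂⟩
    funext e
    induction e using N.wellFounded_edge.induction with
    | _ e ih =>
      rw [hfix e]
      by_cases h : N.tail e ∈ N.sources
      · simp only [F]; rw [dif_pos h, h₁ e h]
      · simp only [F]; rw [dif_neg h, h₂ e h]
        congr 1
        funext e'
        exact ih e'.1 e'.2

/-- The network is solvable over the abelian group `A`: under some code over `A`, every
terminal recovers the sum of the source symbols, whatever these are. -/
def SolvableOver (N : SumNetwork) (A : Type*) [AddCommGroup A] : Prop :=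
  ∃ c : N.Code A, ∀ X : N.sources → A, ∃ Y : N.E → A, c.Carries X Y ∧
    ∀ t : N.terminals, c.decode t (fun e => Y e.1) = ∑ s, X s

end SumNetwork

/-! The network is solvable over `ZMod 4` only through a code built on non-affine permutations.
Symbols `perm j c` and `c - perm j c` mask the `d j k`. Terminal `l j` needs `perm j` injective;
terminal `q` only learns `2 * (c - perm j c)` for both `j`, and these two values must determine `c`.
Terminal `r` adds five symbols `c + x i`, which works because `5 = 1` in `ZMod 4`.

In the reverse, finiteness makes bottleneck functions invertible in the relevant variables, so the
decoding conditions become equations about shifts (`eq_zero_of_functional_equations`). The five `φ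
i` force `4z = 0` for all `z`. A change of `q` is offset by a translation `β j q` of both `a j` and
`b j`; this moves `a j + b j` by `2β`, which is offset by a translation `ε j` of `l j`. Balancing
the total gives `ε true + ε false = 2β true + 2β false + q`. Doing a shift twice moves `a j + b j`
by `4β = 0`, so `2ε = 0`, whence `2q = 0` for all `q`; then `2β = 0`, `ε = 0`, and finally `q = 0`.
-/

namespace SumNetwork

/-! ### Solvability as factorization through local data -/

/-- A network is solvable iff the edge symbols can be assigned so that each is determined by the
symbols entering its tail, and the symbols entering a terminal determine the sum. -/
theorem solvableOver_iff (N : SumNetwork) {A : Type*} [AddCommGroup A] :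
    N.SolvableOver A ↔ ∃ Y : (N.sources → A) → N.E → A,
      (∀ (e : N.E) (h : N.tail e ∈ N.sources) (X X' : N.sources → A),
        X ⟨N.tail e, h⟩ = X' ⟨N.tail e, h⟩ → Y X e = Y X' e) ∧
      (∀ e : N.E, N.tail e ∉ N.sources → ∀ X X' : N.sources → A,
        (∀ e', N.head e' = N.tail e → Y X e' = Y X' e') → Y X e = Y X' e) ∧
      (∀ t ∈ N.terminals, ∀ X X' : N.sources → A,
        (∀ e', N.head e' = t → Y X e' = Y X' e') → ∑ s, X s = ∑ s, X' s) := by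
  constructor
  · rintro ⟨c, hc⟩
    choose Y hY hdec using hc
    refine ⟨Y, fun e h X X' hX => ?_, fun e h X X' hX => ?_, fun t ht X X' hX => ?_⟩
    · rw [(hY X).1 e h, (hY X').1 e h, hX]
    · rw [(hY X).2 e h, (hY X').2 e h]
      exact congrArg _ (funext fun e' => hX e'.1 e'.2)
    · rw [← hdec X ⟨t, ht⟩, ← hdec X' ⟨t, ht⟩]
      exact congrArg _ (funext fun e' => hX e'.1 e'.2)
  · rintro ⟨Y, h₁, h₂, h₃⟩
    refine ⟨⟨fun e h => Function.extend (fun X : N.sources → A => X ⟨N.tail e, h⟩)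
          (fun X => Y X e) 0,
        fun e _ => Function.extend (fun (X : N.sources → A) (e' : N.In (N.tail e)) => Y X e'.1)
          (fun X => Y X e) 0,
        fun t => Function.extend (fun (X : N.sources → A) (e' : N.In (t : N.V)) => Y X e'.1)
          (fun X => ∑ s, X s) 0⟩,
      fun X => ⟨Y X, ⟨fun e h => ?_, fun e h => ?_⟩, fun t => ?_⟩⟩
    · exact (Function.FactorsThrough.extend_apply
        (fun X X' hX => h₁ e h X X' hX) 0 X).symm
    · exact (Function.FactorsThrough.extend_apply
        (f := fun (X : N.sources → A) (e' : N.In (N.tail e)) => Y X e'.1)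
        (fun X X' hX => h₂ e h X X' fun e' he' => congrFun hX ⟨e', he'⟩) 0 X).symm
    · exact Function.FactorsThrough.extend_apply
        (f := fun (X : N.sources → A) (e' : N.In (t : N.V)) => Y X e'.1)
        (fun X X' hX => h₃ t t.2 X X' fun e' he' => congrFun hX ⟨e', he'⟩) 0 X

end SumNetwork

/-! ### Networks with one layer of bottlenecks -/

/-- Data of a sum-network in which every path from a source to a terminal either is a single edge
or runs through exactly one bottleneck edge. -/
structure BottleneckData where
  /-- sources -/
  S : Type
  /-- bottleneck edges -/
  I : Type
  /-- terminals -/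
  T : Type
  [finS : Fintype S]
  [finI : Fintype I]
  [finT : Fintype T]
  /-- the source has an edge to the tail of the bottleneck -/
  feeds : S → I → Prop
  /-- the head of the bottleneck has an edge to the terminal -/
  reaches : I → T → Prop
  /-- the source has an edge to the terminal -/
  sees : S → T → Prop

namespace BottleneckData

attribute [instance] finS finI finT

variable (D : BottleneckData)

/-- The nodes of the network: each bottleneck contributes its two ends. -/
inductive Node
  | src (s : D.S)
  | entry (i : D.I)
  | exit (i : D.I)
  | term (t : D.T)

/-- The edges of the network. -/
inductive Edge
  | mid (i : D.I)
  | up (s : D.S) (i : D.I) (h : D.feeds s i)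
  | down (i : D.I) (t : D.T) (h : D.reaches i t)
  | direct (s : D.S) (t : D.T) (h : D.sees s t)

instance : Finite D.Node :=
  Finite.of_surjective
    (fun z : (D.S ⊕ D.I) ⊕ (D.I ⊕ D.T) =>
      (Sum.elim (Sum.elim .src .entry) (Sum.elim .exit .term) z : D.Node))
    (by rintro (s | i | i | t)
        exacts [⟨.inl (.inl s), rfl⟩, ⟨.inl (.inr i), rfl⟩, ⟨.inr (.inl i), rfl⟩,
          ⟨.inr (.inr t), rfl⟩])

instance : Finite D.Edge :=
  Finite.of_surjective
    (fun z : (D.I ⊕ {z : D.S × D.I // D.feeds z.1 z.2}) ⊕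
        ({z : D.I × D.T // D.reaches z.1 z.2} ⊕ {z : D.S × D.T // D.sees z.1 z.2}) =>
      (Sum.elim (Sum.elim .mid fun z => .up _ _ z.2)
        (Sum.elim (fun z => .down _ _ z.2) fun z => .direct _ _ z.2) z : D.Edge))
    (by rintro (i | ⟨s, i, h⟩ | ⟨i, t, h⟩ | ⟨s, t, h⟩)
        exacts [⟨.inl (.inl i), rfl⟩, ⟨.inl (.inr ⟨(s, i), h⟩), rfl⟩,
          ⟨.inr (.inl ⟨(i, t), h⟩), rfl⟩, ⟨.inr (.inr ⟨(s, t), h⟩), rfl⟩])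

variable {D}

/-- The tail of an edge. -/
def Edge.tail : D.Edge → D.Node
  | .mid i => .entry i
  | .up s _ _ => .src s
  | .down i _ _ => .exit i
  | .direct s _ _ => .src s

/-- The head of an edge. -/
def Edge.head : D.Edge → D.Node
  | .mid i => .exit i
  | .up _ i _ => .entry i
  | .down _ t _ => .term t
  | .direct _ t _ => .term t

/-- The depth of a node, increasing along every edge. -/
def Node.depth : D.Node → ℕ
  | .src _ => 0
  | .entry _ => 1
  | .exit _ => 2
  | .term _ => 3

theorem Edge.depth_lt (e : D.Edge) : e.tail.depth < e.head.depth := by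
  cases e <;> simp [Edge.tail, Edge.head, Node.depth]

variable (D)

theorem src_injective : Function.Injective (Node.src : D.S → D.Node) :=
  fun _ _ h => Node.src.inj h

theorem term_injective : Function.Injective (Node.term : D.T → D.Node) :=
  fun _ _ h => Node.term.inj h

/-- The sum-network described by the data. -/
noncomputable def network : SumNetwork where
  V := D.Node
  E := D.Edge
  finV := Fintype.ofFinite _
  finE := Fintype.ofFinite _
  tail := Edge.tail
  head := Edge.head
  acyclic := fun v h => by
    have key : ∀ a b : D.Node,
        Relation.TransGen (fun a b => ∃ e : D.Edge, e.tail = a ∧ e.head = b) a b →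
          a.depth < b.depth := by
      intro a b hab
      induction hab with
      | single h => obtain ⟨e, rfl, rfl⟩ := h; exact e.depth_lt
      | tail _ h ih => obtain ⟨e, rfl, rfl⟩ := h; exact ih.trans e.depth_lt
    exact lt_irrefl _ (key v v h)
  sources := Finset.univ.map ⟨_, D.src_injective⟩
  terminals := Finset.univ.map ⟨_, D.term_injective⟩
  head_notMem_sources := by
    intro e; cases e <;> simp [Edge.head]
  tail_notMem_terminals := by
    intro e; cases e <;> simp [Edge.tail]

theorem src_mem (s : D.S) : (Node.src s : D.Node) ∈ D.network.sources :=
  Finset.mem_map_of_mem _ (Finset.mem_univ s)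

theorem term_mem (t : D.T) : (Node.term t : D.Node) ∈ D.network.terminals :=
  Finset.mem_map_of_mem _ (Finset.mem_univ t)

/-- The sources of the network, as an indexed family. -/
noncomputable def srcEquiv : D.S ≃ D.network.sources :=
  Equiv.ofBijective (fun s => ⟨.src s, D.src_mem s⟩)
    ⟨fun _ _ h => D.src_injective (congrArg Subtype.val h), by
      rintro ⟨v, hv⟩
      obtain ⟨s, -, rfl⟩ := Finset.mem_map.1 hv
      exact ⟨s, rfl⟩⟩

/-- The terminals of the network, as an indexed family. -/
noncomputable def termEquiv : D.T ≃ D.network.terminals :=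
  Equiv.ofBijective (fun t => ⟨.term t, D.term_mem t⟩)
    ⟨fun _ _ h => D.term_injective (congrArg Subtype.val h), by
      rintro ⟨v, hv⟩
      obtain ⟨t, -, rfl⟩ := Finset.mem_map.1 hv
      exact ⟨t, rfl⟩⟩

/-- Functions for the bottlenecks that let every terminal recover the sum. -/
theorem network_solvableOver {A : Type*} [AddCommGroup A] (f : D.I → (D.S → A) → A)
    (hf : ∀ i X X', (∀ s, D.feeds s i → X s = X' s) → f i X = f i X')
    (hsum : ∀ t X X', (∀ s, D.sees s t → X s = X' s) →
      (∀ i, D.reaches i t → f i X = f i X') → ∑ s, X s = ∑ s, X' s) :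
    D.network.SolvableOver A := by
  let Y : (D.network.sources → A) → D.Edge → A := fun X e => match e with
    | .mid i => f i (X ∘ D.srcEquiv)
    | .up s _ _ => X (D.srcEquiv s)
    | .down i _ _ => f i (X ∘ D.srcEquiv)
    | .direct s _ _ => X (D.srcEquiv s)
  refine (SumNetwork.solvableOver_iff _).2 ⟨Y, ?_, ?_, ?_⟩
  · rintro (i | ⟨s, i, hs⟩ | ⟨i, t, hi⟩ | ⟨s, t, hs⟩) h X X' hX
    · obtain ⟨_, -, he⟩ := Finset.mem_map.1 h
      cases he
    · exact hX
    · obtain ⟨_, -, he⟩ := Finset.mem_map.1 h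
      cases he
    · exact hX
  · rintro (i | ⟨s, i, hs⟩ | ⟨i, t, hi⟩ | ⟨s, t, hs⟩) h X X' hX
    · exact hf i _ _ fun s hs => hX (.up s i hs) rfl
    · exact absurd (D.src_mem s) h
    · exact hX (.mid i) rfl
    · exact absurd (D.src_mem s) h
  · intro t ht X X' hX
    obtain ⟨t, -, rfl⟩ := Finset.mem_map.1 ht
    rw [← D.srcEquiv.sum_comp X, ← D.srcEquiv.sum_comp X']
    exact hsum t _ _ (fun s hs => hX (.direct s t hs) rfl) fun i hi => hX (.down i t hi) rfl

/-- A code for the reverse network gives functions for the bottlenecks of the reverse data. -/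
theorem exists_of_reverse_solvableOver {B : Type*} [AddCommGroup B]
    (h : D.network.reverse.SolvableOver B) :
    ∃ g : D.I → (D.T → B) → B,
      (∀ i X X', (∀ t, D.reaches i t → X t = X' t) → g i X = g i X') ∧
      ∀ s X X', (∀ t, D.sees s t → X t = X' t) →
        (∀ i, D.feeds s i → g i X = g i X') → ∑ t, X t = ∑ t, X' t := by
  obtain ⟨Y, h₁, h₂, h₃⟩ := (SumNetwork.solvableOver_iff _).1 h
  let ext : (D.T → B) → D.network.terminals → B := fun X => X ∘ D.termEquiv.symm
  have hext : ∀ X t, ext X ⟨.term t, D.term_mem t⟩ = X t := fun X t =>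
    congrArg X (D.termEquiv.symm_apply_apply t)
  refine ⟨fun i X => Y (ext X) (.mid i : D.Edge), fun i X X' hX => ?_, fun s X X' hX hg => ?_⟩
  · refine h₂ (.mid i : D.Edge) (fun hm => ?_) _ _ ?_
    · obtain ⟨_, -, he⟩ := Finset.mem_map.1 hm
      cases he
    · rintro (i' | ⟨s, i', hs⟩ | ⟨i', t, hi⟩ | ⟨s, t, hs⟩) he
      · cases he
      · cases he
      · cases he
        exact h₁ (.down i t hi : D.Edge) (D.term_mem t) _ _
          ((hext X t).trans ((hX t hi).trans (hext X' t).symm))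
      · cases he
  · have hsum := h₃ (.src s : D.Node) (D.src_mem s) (ext X) (ext X') ?_
    · exact (D.termEquiv.symm.sum_comp X).symm.trans (hsum.trans (D.termEquiv.symm.sum_comp X'))
    · rintro (i | ⟨s', i, hs⟩ | ⟨i, t, hi⟩ | ⟨s', t, hs⟩) he
      · cases he
      · cases he
        refine h₂ (.up s i hs : D.Edge) (fun hm => ?_) _ _ ?_
        · obtain ⟨_, -, he⟩ := Finset.mem_map.1 hm
          cases he
        · rintro (i' | ⟨s', i', hs⟩ | ⟨i', t, hi⟩ | ⟨s', t, hs⟩) he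
          · cases he
            exact hg i hs
          · cases he
          · cases he
          · cases he
      · cases he
      · cases he
        exact h₁ (.direct s t hs : D.Edge) (D.term_mem t) _ _
          ((hext X t).trans ((hX t hs).trans (hext X' t).symm))

end BottleneckData

/-! ### Functional equations of the reverse network -/

/-- On a finite target, a function from which a surjection can be read off is conversely determined
by this surjection. -/
theorem eq_of_surjective_of_determines {α B : Type*} [Finite B] {φ σ : α → B}
    (hσ : Function.Surjective σ) (h : ∀ x y, φ x = φ y → σ x = σ y) {x y : α}
    (hxy : σ x = σ y) : φ x = φ y := by
  obtain ⟨τ, hτ⟩ := hσ.hasRightInverse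
  have hinj : Function.Injective (φ ∘ τ) := fun u v huv => by
    rw [← hτ u, ← hτ v]; exact h _ _ huv
  have hsurj := Finite.injective_iff_surjective.1 hinj
  obtain ⟨u, hu⟩ := hsurj (φ x)
  obtain ⟨v, hv⟩ := hsurj (φ y)
  have hux := h _ _ hu
  have hvy := h _ _ hv
  rw [hτ] at hux hvy
  rw [← hu, ← hv, hux, hvy, hxy]

/-- The functional equations of the reverse of `IrreversibleData.data` have no solution over
a nontrivial group. -/
theorem eq_zero_of_functional_equations {B : Type*} [AddCommGroup B] [Finite B]
    (f₀ : Bool → B → B → B → B) (f₁ f₂ h : Bool → B → B → B) (φ : Fin 5 → B → B → B)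
    (hφ : ∀ i p r p' r', φ i p r = φ i p' r' → p + r = p' + r')
    (h₀ : ∀ j a b a' b' l, f₀ j a b l = f₀ j a' b' l → a + b = a' + b')
    (h₁ : ∀ j a l q a' l' q', f₁ j a q = f₁ j a' q' → h j l q = h j l' q' →
      a + l + q = a' + l' + q')
    (h₂ : ∀ j b l q b' l' q', f₂ j b q = f₂ j b' q' → h j l q = h j l' q' →
      b + l + q = b' + l' + q')
    (hc : ∀ (a b l a' b' l' : Bool → B) (q q' : B) (p p' : Fin 5 → B) (r r' : B),
      (∀ j, f₀ j (a j) (b j) (l j) = f₀ j (a' j) (b' j) (l' j)) →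
      (∀ j, f₁ j (a j) q = f₁ j (a' j) q') → (∀ j, f₂ j (b j) q = f₂ j (b' j) q') →
      (∀ i, φ i (p i) r = φ i (p' i) r') →
      ∑ j, (a j + b j + l j) + q + ∑ i, p i + r =
        ∑ j, (a' j + b' j + l' j) + q' + ∑ i, p' i + r') (q : B) : q = 0 := by
  -- Each `φ i` depends only on `p i + r`, so replacing `r` by `z` and all five `p i` by `-z` is
  -- invisible at `c`, yet changes the sum by `-4z`.
  have four : ∀ z : B, (4 : ℤ) • z = 0 := by
    intro z
    have hz := hc 0 0 0 0 0 0 0 0 (fun _ => 0) (fun _ => -z) 0 z (fun _ => rfl) (fun _ => rfl)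
      (fun _ => rfl) fun i =>
        eq_of_surjective_of_determines (φ := fun u : B × B => φ i u.1 u.2)
          (σ := fun u : B × B => u.1 + u.2) (fun u => ⟨(u, 0), by simp⟩)
          (fun _ _ => hφ i _ _ _ _) (x := (0, 0)) (y := (-z, z)) (by simp)
    simp at hz
    rw [← neg_eq_zero, hz]
    abel
  -- Choose `κ` with `h j κ q = h j 0 0`. The decoding conditions then fix the compensation of `a`
  -- and of `b` as `-κ - q`, the same for both and independent of their values.
  have hshift : ∀ j q, ∃ β, ∀ a, f₁ j (a + β) q = f₁ j a 0 ∧ f₂ j (a + β) q = f₂ j a 0 := by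
    intro j q
    have hh : Function.Injective fun l => h j l q := fun l l' hl => by
      simpa using h₁ j 0 l q 0 l' q rfl hl
    have hf₁ : Function.Injective fun a => f₁ j a q := fun a a' ha => by
      simpa using h₁ j a 0 q a' 0 q ha rfl
    have hf₂ : Function.Injective fun a => f₂ j a q := fun a a' ha => by
      simpa using h₂ j a 0 q a' 0 q ha rfl
    obtain ⟨κ, hκ⟩ := Finite.injective_iff_surjective.1 hh (h j 0 0)
    refine ⟨-κ - q, fun a => ⟨?_, ?_⟩⟩
    · obtain ⟨a', ha'⟩ := Finite.injective_iff_surjective.1 hf₁ (f₁ j a 0)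
      have e := h₁ j a' κ q a 0 0 ha' hκ
      rw [← ha', show a + (-κ - q) = a' by
        simp only [add_zero] at e; rw [← e]; abel]
    · obtain ⟨a', ha'⟩ := Finite.injective_iff_surjective.1 hf₂ (f₂ j a 0)
      have e := h₂ j a' κ q a 0 0 ha' hκ
      rw [← ha', show a + (-κ - q) = a' by
        simp only [add_zero] at e; rw [← e]; abel]
  choose β hβ using hshift
  let Λ : Bool → B → B → B := fun j u l => f₀ j u 0 l
  have hΛ : ∀ j a b l, f₀ j a b l = Λ j (a + b) l := fun j a b l =>
    eq_of_surjective_of_determines (φ := fun u : B × B => f₀ j u.1 u.2 l)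
      (σ := fun u : B × B => u.1 + u.2) (fun u => ⟨(u, 0), by simp⟩)
      (fun _ _ => h₀ j _ _ _ _ l) (x := (a, b)) (y := (a + b, 0)) (by simp)
  -- Raising `q` from `0` while translating every `a i` and `b i` by `β i q` preserves `f₁` and
  -- `f₂`; the hypotheses preserve `f₀`, so the total cannot change.
  have hmain : ∀ (j : Bool) (q u l l' v m m' : B),
      Λ j u l = Λ j (u + (2 : ℤ) • β j q) l' → Λ (!j) v m = Λ (!j) (v + (2 : ℤ) • β (!j) q) m' →
      l + m = (2 : ℤ) • β j q + (2 : ℤ) • β (!j) q + l' + m' + q := by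
    intro j q u l l' v m m' hj hj'
    have key := hc (fun i => if i = j then u else v) 0 (fun i => if i = j then l else m)
      (fun i => (if i = j then u else v) + β i q) (fun i => β i q)
      (fun i => if i = j then l' else m') 0 q 0 0 0 0 (fun i => ?_) (fun i => (hβ i q _).1.symm)
      (fun i => ?_) fun i => rfl
    · have hne : (!j) ≠ j := by cases j <;> simp
      have hsum : ∀ F : Bool → B, ∑ i, F i = F j + F (!j) := by
        intro F; cases j <;> simp [add_comm]
      rw [hsum, hsum] at key
      simp only [if_true, if_neg hne, Pi.zero_apply, Finset.sum_const_zero] at key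
      linear_combination (norm := module) key
    · rw [hΛ, hΛ]
      by_cases hi : i = j
      · subst hi
        simpa [add_assoc, two_zsmul] using hj
      · obtain rfl : i = !j := Bool.eq_not.2 hi
        simpa [hi, add_assoc, two_zsmul] using hj'
    · simpa using (hβ i q 0).2.symm
  have hβ0 : ∀ j, β j 0 = 0 := fun j => by
    simpa using h₁ j (0 + β j 0) 0 0 0 0 0 (hβ j 0 0).1 rfl
  have hinj : ∀ j u, Function.Injective (Λ j u) := fun j u l l' hl => by
    simpa [hβ0] using hmain j 0 u l l' 0 0 0 (by simpa [hβ0] using hl) (by simp [hβ0])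
  -- The copy `!j` can be held fixed while `u` and `l` vary in copy `j`, so the compensating change
  -- of `l` is a constant.
  have hε : ∀ q, ∃ ε : Bool → B,
      ε true + ε false = (2 : ℤ) • β true q + (2 : ℤ) • β false q + q ∧
      ∀ j u l, Λ j (u + (2 : ℤ) • β j q) (l - ε j) = Λ j u l := by
    intro q
    have hsurj : ∀ j u l, ∃ l', Λ j u l = Λ j (u + (2 : ℤ) • β j q) l' := fun j u l =>
      (Finite.injective_iff_surjective.1 (hinj j _) _).imp fun _ => Eq.symm
    choose ε hε using fun j => hsurj j 0 0
    refine ⟨fun j => -ε j, ?_, fun j u l => ?_⟩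
    · have e := hmain true q 0 0 _ 0 0 _ (hε true) (hε false)
      simp only [Bool.not_true, add_zero] at e
      linear_combination (norm := module) e
    · obtain ⟨l', hl'⟩ := hsurj j u l
      have e := hmain j q u l l' 0 0 _ hl' (hε (!j))
      have e₀ := hmain j q 0 0 _ 0 0 _ (hε j) (hε (!j))
      rw [hl']
      congr 1
      linear_combination (norm := module) e - e₀
  have hε2 : ∀ j q e, (∀ u l, Λ j (u + (2 : ℤ) • β j q) (l - e) = Λ j u l) →
      (2 : ℤ) • e = 0 := by
    intro j q e he
    have h2 := (he (0 + (2 : ℤ) • β j q) (0 - e)).trans (he 0 0)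
    rw [show (0 : B) + (2 : ℤ) • β j q + (2 : ℤ) • β j q = (4 : ℤ) • β j q by abel, four] at h2
    have := hinj j 0 h2
    rw [← neg_eq_zero, ← this]
    abel
  have two : ∀ z : B, (2 : ℤ) • z = 0 := by
    intro z
    obtain ⟨ε, hsum, he⟩ := hε z
    have := congrArg (fun y => (2 : ℤ) • y) hsum
    simp only [smul_add, hε2 _ _ _ (he true), hε2 _ _ _ (he false), smul_smul] at this
    norm_num [four] at this
    exact this.symm
  obtain ⟨ε, hsum, he⟩ := hε q
  have hzero : ∀ j, ε j = 0 := fun j => by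
    have := he j 0 0
    rw [two, add_zero] at this
    simpa using hinj j 0 this
  simpa [two, hzero] using hsum.symm

/-! ### The network -/

namespace IrreversibleData

/-- The sources. -/
inductive Src
  | c
  | d (j : Bool) (k : Fin 3)
  | x (i : Fin 5)

/-- The bottlenecks. -/
inductive Neck
  | f (j : Bool) (k : Fin 3)
  | h (j : Bool)
  | φ (i : Fin 5)

/-- The terminals. -/
inductive Trm
  | a (j : Bool)
  | b (j : Bool)
  | l (j : Bool)
  | q
  | p (i : Fin 5)
  | r

/-- The sources, as a sum type. -/
def srcEquiv : (Unit ⊕ Bool × Fin 3) ⊕ Fin 5 ≃ Src where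
  toFun
    | .inl (.inl _) => .c
    | .inl (.inr z) => .d z.1 z.2
    | .inr i => .x i
  invFun
    | .c => .inl (.inl ())
    | .d j k => .inl (.inr (j, k))
    | .x i => .inr i
  left_inv := by rintro ((_ | _) | _) <;> rfl
  right_inv := by rintro (_ | _ | _) <;> rfl

/-- The bottlenecks, as a sum type. -/
def neckEquiv : (Bool × Fin 3 ⊕ Bool) ⊕ Fin 5 ≃ Neck where
  toFun
    | .inl (.inl z) => .f z.1 z.2
    | .inl (.inr j) => .h j
    | .inr i => .φ i
  invFun
    | .f j k => .inl (.inl (j, k))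
    | .h j => .inl (.inr j)
    | .φ i => .inr i
  left_inv := by rintro ((_ | _) | _) <;> rfl
  right_inv := by rintro (_ | _ | _) <;> rfl

/-- The terminals, as a sum type. -/
def trmEquiv : ((Bool ⊕ Bool ⊕ Bool) ⊕ Unit) ⊕ Fin 5 ⊕ Unit ≃ Trm where
  toFun
    | .inl (.inl (.inl j)) => .a j
    | .inl (.inl (.inr (.inl j))) => .b j
    | .inl (.inl (.inr (.inr j))) => .l j
    | .inl (.inr _) => .q
    | .inr (.inl i) => .p i
    | .inr (.inr _) => .r
  invFun
    | .a j => .inl (.inl (.inl j))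
    | .b j => .inl (.inl (.inr (.inl j)))
    | .l j => .inl (.inl (.inr (.inr j)))
    | .q => .inl (.inr ())
    | .p i => .inr (.inl i)
    | .r => .inr (.inr ())
  left_inv := by rintro (((_ | _ | _) | _) | _ | _) <;> rfl
  right_inv := by rintro (_ | _ | _ | _ | _ | _) <;> rfl

instance : Fintype Src := Fintype.ofEquiv _ srcEquiv
instance : Fintype Neck := Fintype.ofEquiv _ neckEquiv
instance : Fintype Trm := Fintype.ofEquiv _ trmEquiv

/-- Singling out the copy `j` lets a terminal attached to it cancel the other copy, which it sees
directly. -/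
theorem sum_src {A : Type*} [AddCommGroup A] (X : Src → A) (j : Bool) :
    ∑ s, X s = X .c + (X (.d j 0) + X (.d j 1) + X (.d j 2)) +
      (X (.d (!j) 0) + X (.d (!j) 1) + X (.d (!j) 2)) + ∑ i, X (.x i) := by
  rw [← srcEquiv.sum_comp]
  cases j <;> simp [Fintype.sum_prod_type, Fin.sum_univ_three, srcEquiv] <;> abel

theorem sum_trm {A : Type*} [AddCommGroup A] (X : Trm → A) :
    ∑ t, X t = ∑ j, (X (.a j) + X (.b j) + X (.l j)) + X .q + ∑ i, X (.p i) + X .r := by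
  rw [← trmEquiv.sum_comp]
  simp [trmEquiv]
  abel

/-- The sources feeding each bottleneck. -/
def feeds : Src → Neck → Prop
  | .c, .f _ _ => True
  | .c, .φ _ => True
  | .d j k, .f j' k' => j = j' ∧ k = k'
  | .d j k, .h j' => j = j' ∧ k ≠ 0
  | .x i, .φ i' => i = i'
  | _, _ => False

/-- The terminals reached by each bottleneck. -/
def reaches : Neck → Trm → Prop
  | .f j k, .a j' => j = j' ∧ k ≠ 2
  | .f j k, .b j' => j = j' ∧ k ≠ 1
  | .f j k, .l j' => j = j' ∧ k = 0
  | .f _ k, .q => k ≠ 0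
  | .h j, .l j' => j = j'
  | .h _, .q => True
  | .φ i, .p i' => i = i'
  | .φ _, .r => True
  | _, _ => False

/-- The terminals with an edge from each source. -/
def sees : Src → Trm → Prop
  | .c, _ => False
  | .d j k, .a j' => j = j' → k = 2
  | .d j k, .b j' => j = j' → k = 1
  | .d j k, .l j' => j = j' → k = 0
  | .d _ k, .q => k = 0
  | .d _ _, _ => True
  | .x i, .p i' => i ≠ i'
  | .x _, .r => False
  | .x _, _ => True

/-- The data of the network that is solvable although its reverse is not. -/
def data : BottleneckData where
  S := Src
  I := Neck
  T := Trm
  feeds := feeds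
  reaches := reaches
  sees := sees

/-! ### The code over `ℤ/4` -/

/-- Two permutations `π` of `ℤ/4` such that the two values `2 (c - π c)` together determine `c`. -/
def perm : Bool → ZMod 4 → ZMod 4
  | true => ![0, 1, 3, 2]
  | false => ![0, 2, 1, 3]

theorem perm_injective : ∀ j c c', perm j c = perm j c' → c = c' := by decide

/-- For `c = 0, 1, 2, 3` the values are `0, 0, 2, 2` (for `true`) and `0, 2, 2, 0` (for `false`). An
affine permutation would give a constant, and one permutation alone gives at most two values. -/
theorem eq_of_two_mul_sub_perm : ∀ c c' : ZMod 4,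
    (∀ j, 2 * (c - perm j c) = 2 * (c' - perm j c')) → c = c' := by decide

/-- The bottleneck functions over `ℤ/4`. -/
def symbol : Neck → (Src → ZMod 4) → ZMod 4
  | .f j k, X => (if k = 0 then perm j (X .c) else X .c - perm j (X .c)) + X (.d j k)
  | .h j, X => X (.d j 1) + X (.d j 2)
  | .φ i, X => X .c + X (.x i)

theorem solvableOver_four : data.network.SolvableOver (ZMod 4) := by
  refine data.network_solvableOver symbol ?_ ?_
  · rintro (⟨j, k⟩ | j | i) X X' hX
    · simp only [symbol]
      rw [hX Src.c trivial, hX (Src.d j k) ⟨rfl, rfl⟩]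
    · simp only [symbol]
      rw [hX (Src.d j 1) ⟨rfl, by decide⟩, hX (Src.d j 2) ⟨rfl, by decide⟩]
    · simp only [symbol]
      rw [hX Src.c trivial, hX (Src.x i) rfl]
  · intro t X X' hs hi
    change ∑ s : Src, X s = ∑ s : Src, X' s
    have hne : ∀ j : Bool, (!j) ≠ j := by decide
    rcases t with j | j | j | _ | i | _
    · have e₀ : perm j (X .c) + X (.d j 0) = perm j (X' .c) + X' (.d j 0) :=
        hi (Neck.f j 0) ⟨rfl, by decide⟩
      have e₁ : X .c - perm j (X .c) + X (.d j 1) =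
          X' .c - perm j (X' .c) + X' (.d j 1) :=
        hi (Neck.f j 1) ⟨rfl, by decide⟩
      have e := fun k => hs (Src.d (!j) k) fun h => absurd h (hne j)
      rw [sum_src X j, sum_src X' j, e, e, e, hs (Src.d j 2) fun _ => rfl,
        Finset.sum_congr rfl fun i _ => hs (Src.x i) trivial]
      linear_combination e₀ + e₁
    · have e₀ : perm j (X .c) + X (.d j 0) = perm j (X' .c) + X' (.d j 0) :=
        hi (Neck.f j 0) ⟨rfl, by decide⟩
      have e₁ : X .c - perm j (X .c) + X (.d j 2) =
          X' .c - perm j (X' .c) + X' (.d j 2) :=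
        hi (Neck.f j 2) ⟨rfl, by decide⟩
      have e := fun k => hs (Src.d (!j) k) fun h => absurd h (hne j)
      rw [sum_src X j, sum_src X' j, e, e, e, hs (Src.d j 1) fun _ => rfl,
        Finset.sum_congr rfl fun i _ => hs (Src.x i) trivial]
      linear_combination e₀ + e₁
    · have e₀ : perm j (X .c) + X (.d j 0) = perm j (X' .c) + X' (.d j 0) :=
        hi (Neck.f j 0) ⟨rfl, rfl⟩
      have e₁ : X (.d j 1) + X (.d j 2) = X' (.d j 1) + X' (.d j 2) := hi (Neck.h j) rfl
      have e₂ := hs (Src.d j 0) fun _ => rfl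
      have hc : X .c = X' .c := perm_injective j _ _ (by linear_combination e₀ - e₂)
      have e := fun k => hs (Src.d (!j) k) fun h => absurd h (hne j)
      rw [sum_src X j, sum_src X' j, e, e, e, e₂, hc,
        Finset.sum_congr rfl fun i _ => hs (Src.x i) trivial]
      linear_combination e₁
    · have e₁ : ∀ j, X .c - perm j (X .c) + X (.d j 1) =
          X' .c - perm j (X' .c) + X' (.d j 1) := fun j =>
        hi (Neck.f j 1) (show (1 : Fin 3) ≠ 0 by decide)
      have e₂ : ∀ j, X .c - perm j (X .c) + X (.d j 2) =
          X' .c - perm j (X' .c) + X' (.d j 2) := fun j =>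
        hi (Neck.f j 2) (show (2 : Fin 3) ≠ 0 by decide)
      have e : ∀ j, X (.d j 1) + X (.d j 2) = X' (.d j 1) + X' (.d j 2) := fun j =>
        hi (Neck.h j) trivial
      -- The two masked symbols minus `h j` leave `2 * (c - perm j c)`.
      have hc : X .c = X' .c := eq_of_two_mul_sub_perm _ _ fun j => by
        linear_combination e₁ j + e₂ j - e j
      rw [sum_src X true, sum_src X' true, hc, hs (Src.d _ 0) rfl, hs (Src.d _ 0) rfl,
        Finset.sum_congr rfl fun i _ => hs (Src.x i) trivial]
      linear_combination e true + e (!true)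
    · have e : X .c + X (.x i) = X' .c + X' (.x i) := hi (Neck.φ i) rfl
      have hd := fun j k => hs (Src.d j k) trivial
      rw [sum_src X true, sum_src X' true, hd, hd, hd, hd, hd, hd,
        ← Finset.add_sum_erase _ _ (Finset.mem_univ i),
        ← Finset.add_sum_erase _ (fun i => X' (.x i)) (Finset.mem_univ i),
        Finset.sum_congr rfl fun i' hi' => hs (Src.x i') (Finset.ne_of_mem_erase hi')]
      linear_combination e
    · have e : ∀ i, X .c + X (.x i) = X' .c + X' (.x i) := fun i => hi (Neck.φ i) trivial
      have hd := fun j k => hs (Src.d j k) trivial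
      rw [sum_src X true, sum_src X' true, hd, hd, hd, hd, hd, hd, Fin.sum_univ_five,
        Fin.sum_univ_five]
      have h4 : (4 : ZMod 4) = 0 := rfl
      -- The five symbols add up to `5c + ∑ x i`; the surplus `4c` vanishes.
      linear_combination e 0 + e 1 + e 2 + e 3 + e 4 - (X .c - X' .c) * h4

/-! ### Unsolvability of the reverse network -/

/-- The source symbols of the reverse network with given values. -/
def values {B : Type*} (a b l : Bool → B) (q : B) (p : Fin 5 → B) (r : B) : Trm → B
  | .a j => a j
  | .b j => b j
  | .l j => l j
  | .q => q
  | .p i => p i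
  | .r => r

theorem exists_local_functions {B : Type*} [Zero B] (g : Neck → (Trm → B) → B)
    (hg : ∀ i X X', (∀ t, reaches i t → X t = X' t) → g i X = g i X') :
    ∃ (f₀ : Bool → B → B → B → B) (f₁ f₂ k : Bool → B → B → B) (φ : Fin 5 → B → B → B),
      (∀ j X, g (.f j 0) X = f₀ j (X (.a j)) (X (.b j)) (X (.l j))) ∧
      (∀ j X, g (.f j 1) X = f₁ j (X (.a j)) (X .q)) ∧
      (∀ j X, g (.f j 2) X = f₂ j (X (.b j)) (X .q)) ∧
      (∀ j X, g (.h j) X = k j (X (.l j)) (X .q)) ∧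
      ∀ i X, g (.φ i) X = φ i (X (.p i)) (X .r) := by
  refine ⟨fun j a b l => g (.f j 0) (values (fun _ => a) (fun _ => b) (fun _ => l) 0 0 0),
    fun j a q => g (.f j 1) (values (fun _ => a) 0 0 q 0 0),
    fun j b q => g (.f j 2) (values 0 (fun _ => b) 0 q 0 0),
    fun j l q => g (.h j) (values 0 0 (fun _ => l) q 0 0),
    fun i p r => g (.φ i) (values 0 0 0 0 (fun _ => p) r), ?_, ?_, ?_, ?_, ?_⟩ <;>
  · intro _ X
    refine hg _ _ _ ?_
    rintro (_ | _ | _ | _ | _ | _) <;> simp +contextual [reaches, values]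

/-- The decoding condition at each node is tested on symbols that vanish wherever that node sees
them directly, except for a common `l` at `d j 0`; what remains is one of the functional equations.
-/
theorem eq_zero_of_reverse {B : Type*} [AddCommGroup B] [Finite B] (g : Neck → (Trm → B) → B)
    (hg : ∀ i X X', (∀ t, reaches i t → X t = X' t) → g i X = g i X')
    (hs : ∀ s X X', (∀ t, sees s t → X t = X' t) → (∀ i, feeds s i → g i X = g i X') →
      ∑ t, X t = ∑ t, X' t) (z : B) : z = 0 := by
  obtain ⟨f₀, f₁, f₂, k, φ, hf₀, hf₁, hf₂, hk, hφ⟩ := exists_local_functions g hg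
  refine eq_zero_of_functional_equations f₀ f₁ f₂ k φ ?_ ?_ ?_ ?_ ?_ z
  · intro i p r p' r' h
    have := hs (.x i) (values 0 0 0 0 (Pi.single i p) r) (values 0 0 0 0 (Pi.single i p') r')
      (by rintro (_ | _ | _ | _ | i' | _) <;> grind [sees, values])
      (by
        rintro (_ | _ | i') ht <;> simp only [feeds] at ht
        subst ht
        rw [hφ, hφ]
        simpa [values] using h)
    simpa [sum_trm, values] using this
  · intro j a b a' b' l h
    have := hs (.d j 0) (values (Pi.single j a) (Pi.single j b) (Pi.single j l) 0 0 0)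
      (values (Pi.single j a') (Pi.single j b') (Pi.single j l) 0 0 0)
      (by rintro (_ | _ | _ | _ | _ | _) <;> grind [sees, values])
      (by
        rintro (⟨j', k'⟩ | _ | _) ht <;> simp only [feeds] at ht
        · obtain ⟨rfl, rfl⟩ := ht
          rw [hf₀, hf₀]
          simpa [values] using h
        · exact absurd rfl ht.2)
    simpa [sum_trm, values, Finset.sum_add_distrib] using this
  · intro j a l q a' l' q' h₁ h₂
    have := hs (.d j 1) (values (Pi.single j a) 0 (Pi.single j l) q 0 0)
      (values (Pi.single j a') 0 (Pi.single j l') q' 0 0)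
      (by rintro (_ | _ | _ | _ | _ | _) <;> grind [sees, values])
      (by
        rintro (⟨j', k'⟩ | _ | _) ht <;> simp only [feeds] at ht
        · obtain ⟨rfl, rfl⟩ := ht
          rw [hf₁, hf₁]
          simpa [values] using h₁
        · obtain ⟨rfl, -⟩ := ht
          rw [hk, hk]
          simpa [values] using h₂)
    simpa [sum_trm, values, Finset.sum_add_distrib] using this
  · intro j b l q b' l' q' h₁ h₂
    have := hs (.d j 2) (values 0 (Pi.single j b) (Pi.single j l) q 0 0)
      (values 0 (Pi.single j b') (Pi.single j l') q' 0 0)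
      (by rintro (_ | _ | _ | _ | _ | _) <;> grind [sees, values])
      (by
        rintro (⟨j', k'⟩ | _ | _) ht <;> simp only [feeds] at ht
        · obtain ⟨rfl, rfl⟩ := ht
          rw [hf₂, hf₂]
          simpa [values] using h₁
        · obtain ⟨rfl, -⟩ := ht
          rw [hk, hk]
          simpa [values] using h₂)
    simpa [sum_trm, values, Finset.sum_add_distrib] using this
  · intro a b l a' b' l' q q' p p' r r' h₀ h₁ h₂ h₃
    have := hs .c (values a b l q p r) (values a' b' l' q' p' r') (fun _ => False.elim) (by
      rintro (⟨j, k'⟩ | _ | i) ht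
      · obtain rfl | rfl | rfl : k' = 0 ∨ k' = 1 ∨ k' = 2 := by clear ht; revert k'; decide
        · rw [hf₀, hf₀]; exact h₀ j
        · rw [hf₁, hf₁]; exact h₁ j
        · rw [hf₂, hf₂]; exact h₂ j
      · exact ht.elim
      · rw [hφ, hφ]; exact h₃ i)
    simpa only [sum_trm, values] using this

theorem not_reverse_solvableOver (B : Type*) [AddCommGroup B] [Finite B] [Nontrivial B] :
    ¬ data.network.reverse.SolvableOver B := by
  intro h
  obtain ⟨g, hg, hs⟩ := data.exists_of_reverse_solvableOver h
  obtain ⟨z, hz⟩ := exists_ne (0 : B)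
  exact hz (eq_zero_of_reverse g hg hs z)

end IrreversibleData

theorem mainTheorem6 :
    ∃ N : SumNetwork,
      (∃ (A : Type) (_ : AddCommGroup A), Finite A ∧ Nontrivial A ∧ N.SolvableOver A) ∧
      ∀ (B : Type*) [AddCommGroup B] [Finite B] [Nontrivial B], ¬ N.reverse.SolvableOver B :=
  ⟨IrreversibleData.data.network,
    ⟨ZMod 4, inferInstance, inferInstance, ⟨0, 1, by decide⟩, IrreversibleData.solvableOver_four⟩,
    fun B => IrreversibleData.not_reverse_solvableOver B⟩
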